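/- Let $k$ be a field. All schemes below are of finite type over $k$, and $\pi$, $i$, $j$ are morphisms over $k$. For an ideal $I$ of a commutative ring $R$ write $\mathrm{Rees}_R(I)=\bigoplus_{d\ge 0} I^d$. For closed embeddings $Y\subset X\subset M$, with ideal sheaves $\mathcal J_{Y,X}\subset\mathcal O_X$ and $\mathcal J_{Y,M}\subset\mathcal O_M$ of $Y$ in $X$ and in $M$, the quasi-symmetric algebra is the sheaf of graded $\mathcal O_X$-algebras $$\mathrm{qSym}_{X\subset M}(\mathcal J_{Y,X}):=\mathrm{Sym}_{\mathcal O_X}(\mathcal J_{Y,X})\otimes_{\mathrm{Sym}_{\mathcal O_M}(\mathcal J_{Y,M})}\mathrm{Rees}_{\mathcal O_M}(\mathcal J_{Y,M}).$$ That is, it is the sheaf on $X$ associated with the local construction $\mathrm{Sym}_A(\mathfrak a)\otimes_{\mathrm{Sym}_R(I)}\mathrm{Rees}_R(I)$, where $V\subset M$ is open, $R=\mathcal O_M(V)$, $A=\mathcal O_X(X\cap V)$, $\mathfrak a=\mathcal J_{Y,X}(X\cap V)$, and $I=\mathcal J_{Y,M}(V)$ is the inverse image of $\mathfrak a$ in $R$.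 A morphism $\pi:N\to M$ compatible with closed embeddings $i:X\hookrightarrow M$ and $j:X\hookrightarrow N$ (that is, $\pi\circ j=i$) induces, by functoriality of $\mathrm{Sym}$ and $\mathrm{Rees}$, an epimorphism of graded $\mathcal O_X$-algebras $\mathrm{qSym}_{X\subset M}(\mathcal J_{Y,X})\to\mathrm{qSym}_{X\subset N}(\mathcal J_{Y,X})$. Theorem. If $\pi:N\to M$ is a smooth morphism compatible with closed embeddings $X\subset M$ and $X\subset N$, then for every closed subscheme $Y\subset X$ the induced epimorphism $$\mathrm{qSym}_{X\subset M}(\mathcal J_{Y,X})\longrightarrow\mathrm{qSym}_{X\subset N}(\mathcal J_{Y,X})$$ is an isomorphism of sheaves of graded $\mathcal O_X$-algebras. -/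

import Mathlib

open CategoryTheory AlgebraicGeometry TopologicalSpace Opposite
open scoped TensorProduct

universe u

noncomputable section

/- Symmetric algebras, Rees algebras and the local quasi-symmetric algebra -/

namespace QuasiSym

section Local

variable {R S T A B C : Type u} [CommRing R] [CommRing S] [CommRing T]
  [CommRing A] [CommRing B] [CommRing C]

/-- The canonical map `Sym_R(I) → Rees_R(I) = ⨁ Iᵈ tᵈ ⊆ R[t]`, sending `x ∈ I` to `x t`. -/
def symToRees (I : Ideal R) : SymmetricAlgebra R I →ₐ[R] reesAlgebra I :=
  SymmetricAlgebra.lift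
    { toFun := fun x => ⟨Polynomial.monomial 1 (x : R),
        reesAlgebra.monomial_mem.mpr (by simp)⟩
      map_add' := fun x y => Subtype.ext (by simp)
      map_smul' := fun r x => Subtype.ext (by simp [Polynomial.smul_monomial]) }

/-- Functoriality of `Sym`: a ring map `φ : R → S` with `φ(I) ⊆ J` induces
`Sym_R(I) → Sym_S(J)`. -/
def symMap (φ : R →+* S) (I : Ideal R) (J : Ideal S) (h : I ≤ J.comap φ) :
    SymmetricAlgebra R I →+* SymmetricAlgebra S J :=
  letI : Algebra R (SymmetricAlgebra S J) :=
    ((algebraMap S (SymmetricAlgebra S J)).comp φ).toAlgebra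
  (SymmetricAlgebra.lift
    ({ toFun := fun x => SymmetricAlgebra.ι S J ⟨φ x, h x.2⟩
       map_add' := fun x y => by
        rw [← map_add]; congr 1; exact Subtype.ext (by simp)
       map_smul' := fun r x => by
        have : (⟨φ (r • x : I), h (r • x : I).2⟩ : J) = φ r • ⟨φ x, h x.2⟩ :=
          Subtype.ext (by simp)
        rw [this, map_smul, Algebra.smul_def, Algebra.smul_def]; rfl } :
      I →ₗ[R] SymmetricAlgebra S J)).toRingHom

/-- Functoriality of `Rees`: a ring map `φ : R → S` with `φ(I) ⊆ J` induces
`Rees_R(I) → Rees_S(J)`, applying `φ` to coefficients. -/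
def reesMap (φ : R →+* S) (I : Ideal R) (J : Ideal S) (h : I ≤ J.comap φ) :
    reesAlgebra I →+* reesAlgebra J :=
  ((Polynomial.mapRingHom φ).comp (reesAlgebra I).val.toRingHom).codRestrict
    (reesAlgebra J) (fun p n => by
      have := Ideal.pow_right_mono h n (p.2 n)
      simpa using Ideal.le_comap_pow φ n this)

@[simp]
lemma symToRees_ι (I : Ideal R) (x : I) :
    ((symToRees I (SymmetricAlgebra.ι R I x) : reesAlgebra I) : Polynomial R) =
      Polynomial.monomial 1 (x : R) := by
  simp [symToRees]

@[simp]
lemma symMap_ι (φ : R →+* S) (I : Ideal R) (J : Ideal S) (h : I ≤ J.comap φ) (x : I) :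
    symMap φ I J h (SymmetricAlgebra.ι R I x) = SymmetricAlgebra.ι S J ⟨φ x, h x.2⟩ := by
  let : Algebra R (SymmetricAlgebra S J) :=
    ((algebraMap S (SymmetricAlgebra S J)).comp φ).toAlgebra
  exact SymmetricAlgebra.lift_ι_apply _ x

@[simp]
lemma symMap_algebraMap (φ : R →+* S) (I : Ideal R) (J : Ideal S) (h : I ≤ J.comap φ) (r : R) :
    symMap φ I J h (algebraMap R _ r) = algebraMap S _ (φ r) := by
  let : Algebra R (SymmetricAlgebra S J) :=
    ((algebraMap S (SymmetricAlgebra S J)).comp φ).toAlgebra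
  exact AlgHom.commutes (SymmetricAlgebra.lift _) r

@[simp]
lemma reesMap_coe (φ : R →+* S) (I : Ideal R) (J : Ideal S) (h : I ≤ J.comap φ)
    (p : reesAlgebra I) :
    ((reesMap φ I J h p : reesAlgebra J) : Polynomial S) = (p : Polynomial R).map φ := rfl

/-- Ring maps out of a symmetric algebra are determined on scalars and on degree one. -/
lemma sym_hom_ext {I : Ideal R} {f g : SymmetricAlgebra R I →+* S}
    (h₀ : ∀ r : R, f (algebraMap R _ r) = g (algebraMap R _ r))
    (h₁ : ∀ x : I, f (SymmetricAlgebra.ι R I x) = g (SymmetricAlgebra.ι R I x)) : f = g := by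
  refine RingHom.ext fun x => ?_
  exact SymmetricAlgebra.induction R I (motive := fun x => f x = g x) h₀ h₁
    (fun a b ha hb => by rw [map_mul, map_mul, ha, hb])
    (fun a b ha hb => by rw [map_add, map_add, ha, hb]) x

lemma symMap_comp (φ : R →+* S) (ψ : S →+* T) (I : Ideal R) (J : Ideal S) (K : Ideal T)
    (h : I ≤ J.comap φ) (h' : J ≤ K.comap ψ) (h'' : I ≤ K.comap (ψ.comp φ)) :
    (symMap ψ J K h').comp (symMap φ I J h) = symMap (ψ.comp φ) I K h'' :=
  sym_hom_ext (fun r => by simp) (fun x => by simp)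

lemma reesMap_comp (φ : R →+* S) (ψ : S →+* T) (I : Ideal R) (J : Ideal S) (K : Ideal T)
    (h : I ≤ J.comap φ) (h' : J ≤ K.comap ψ) (h'' : I ≤ K.comap (ψ.comp φ)) :
    (reesMap ψ J K h').comp (reesMap φ I J h) = reesMap (ψ.comp φ) I K h'' := by
  ext x : 2
  simp [Polynomial.map_map]

lemma symToRees_natural (φ : R →+* S) (I : Ideal R) (J : Ideal S) (h : I ≤ J.comap φ) :
    (reesMap φ I J h).comp (symToRees I).toRingHom =
      (symToRees J).toRingHom.comp (symMap φ I J h) := by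
  refine sym_hom_ext (fun r => Subtype.ext ?_) (fun x => Subtype.ext ?_)
  · simp
  · simp

/-- `Sym_A(a)` as an algebra over `Sym_R(I)`, where `I` is the inverse image of `a` in `R`. -/
abbrev symAlgebra (φ : R →+* A) (a : Ideal A) :
    Algebra (SymmetricAlgebra R (a.comap φ)) (SymmetricAlgebra A a) :=
  (symMap φ (a.comap φ) a le_rfl).toAlgebra

/-- `Rees_R(I)` as an algebra over `Sym_R(I)`. -/
abbrev reesSymAlgebra (I : Ideal R) : Algebra (SymmetricAlgebra R I) (reesAlgebra I) :=
  (symToRees I).toRingHom.toAlgebra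

attribute [local instance] symAlgebra reesSymAlgebra

/-- The quasi-symmetric algebra of an ideal `a` of `A` relative to `φ : R → A`:
`Sym_A(a) ⊗_{Sym_R(I)} Rees_R(I)`, where `I` is the inverse image of `a` in `R`. -/
def QSym (φ : R →+* A) (a : Ideal A) : Type u :=
  SymmetricAlgebra A a ⊗[SymmetricAlgebra R (a.comap φ)] reesAlgebra (a.comap φ)

namespace QSym

instance (φ : R →+* A) (a : Ideal A) : CommRing (QSym φ a) :=
  inferInstanceAs (CommRing
    (SymmetricAlgebra A a ⊗[SymmetricAlgebra R (a.comap φ)] reesAlgebra (a.comap φ)))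

/-- `s ↦ s ⊗ 1`. -/
def inl (φ : R →+* A) (a : Ideal A) : SymmetricAlgebra A a →+* QSym φ a :=
  Algebra.TensorProduct.includeLeftRingHom

/-- `r ↦ 1 ⊗ r`. -/
def inr (φ : R →+* A) (a : Ideal A) : reesAlgebra (a.comap φ) →+* QSym φ a :=
  (Algebra.TensorProduct.includeRight (R := SymmetricAlgebra R (a.comap φ))
    (A := SymmetricAlgebra A a) (B := reesAlgebra (a.comap φ))).toRingHom

lemma inl_comp_symMap (φ : R →+* A) (a : Ideal A) :
    (inl φ a).comp (symMap φ (a.comap φ) a le_rfl) =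
      (inr φ a).comp (symToRees (a.comap φ)).toRingHom := by
  exact Algebra.TensorProduct.includeLeftRingHom_comp_algebraMap

/-- The universal property of the tensor product of commutative rings. -/
def lift (φ : R →+* A) (a : Ideal A) (f : SymmetricAlgebra A a →+* B)
    (g : reesAlgebra (a.comap φ) →+* B)
    (h : f.comp (symMap φ (a.comap φ) a le_rfl) = g.comp (symToRees (a.comap φ)).toRingHom) :
    QSym φ a →+* B :=
  letI : Algebra (SymmetricAlgebra R (a.comap φ)) B :=
    (f.comp (symMap φ (a.comap φ) a le_rfl)).toAlgebra
  (Algebra.TensorProduct.lift (R := SymmetricAlgebra R (a.comap φ))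
    (S := SymmetricAlgebra R (a.comap φ))
    (⟨f, fun _ => rfl⟩ : SymmetricAlgebra A a →ₐ[SymmetricAlgebra R (a.comap φ)] B)
    (⟨g, fun r => (RingHom.congr_fun h r).symm⟩ :
      reesAlgebra (a.comap φ) →ₐ[SymmetricAlgebra R (a.comap φ)] B)
    (fun _ _ => Commute.all _ _)).toRingHom

@[simp]
lemma lift_inl (φ : R →+* A) (a : Ideal A) (f : SymmetricAlgebra A a →+* B)
    (g : reesAlgebra (a.comap φ) →+* B) (h) (s : SymmetricAlgebra A a) :
    lift φ a f g h (inl φ a s) = f s := by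
  let : Algebra (SymmetricAlgebra R (a.comap φ)) B :=
    (f.comp (symMap φ (a.comap φ) a le_rfl)).toAlgebra
  refine (Algebra.TensorProduct.lift_tmul _ _ _ _ _).trans ?_
  rw [map_one, mul_one]; rfl

@[simp]
lemma lift_inr (φ : R →+* A) (a : Ideal A) (f : SymmetricAlgebra A a →+* B)
    (g : reesAlgebra (a.comap φ) →+* B) (h) (r : reesAlgebra (a.comap φ)) :
    lift φ a f g h (inr φ a r) = g r := by
  let : Algebra (SymmetricAlgebra R (a.comap φ)) B :=
    (f.comp (symMap φ (a.comap φ) a le_rfl)).toAlgebra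
  refine (Algebra.TensorProduct.lift_tmul _ _ _ _ _).trans ?_
  rw [map_one, one_mul]; rfl

lemma hom_ext {φ : R →+* A} {a : Ideal A} {f g : QSym φ a →+* B}
    (hl : f.comp (inl φ a) = g.comp (inl φ a)) (hr : f.comp (inr φ a) = g.comp (inr φ a)) :
    f = g := by
  exact Algebra.TensorProduct.ringHom_ext
    (A := SymmetricAlgebra A a) (B := reesAlgebra (a.comap φ)) hl hr

/-- The structure map of the `A`-algebra `QSym φ a`. -/
def scalar (φ : R →+* A) (a : Ideal A) : A →+* QSym φ a :=
  (inl φ a).comp (algebraMap A (SymmetricAlgebra A a))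

/-- The degree `d` part of `QSym φ a`: it is spanned by the products `s ⊗ r` with
`s ∈ Sym_A^p(a)`, `r ∈ I^q t^q` and `p + q = d`. -/
def degree (φ : R →+* A) (a : Ideal A) (d : ℕ) : AddSubgroup (QSym φ a) :=
  AddSubgroup.closure
    {z | ∃ (p q : ℕ) (s : SymmetricAlgebra A a) (r : reesAlgebra (a.comap φ)),
      p + q = d ∧ s ∈ LinearMap.range (SymmetricAlgebra.ι A a) ^ p ∧
      (∃ c : R, (r : Polynomial R) = Polynomial.monomial q c) ∧
      z = inl φ a s * inr φ a r}

section Map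

variable (φ : R →+* A) (a : Ideal A) (ψ : S →+* B) (b : Ideal B) (χ : T →+* C) (c : Ideal C)
  (α : R →+* S) (β : A →+* B) (γ : S →+* T) (δ : B →+* C)

lemma comap_le_comap (w : ψ.comp α = β.comp φ) (h : a ≤ b.comap β) :
    a.comap φ ≤ (b.comap ψ).comap α := by
  rw [Ideal.comap_comap, w, ← Ideal.comap_comap]
  exact Ideal.comap_mono h

/-- Functoriality of the quasi-symmetric algebra: a commutative square `ψ ∘ α = β ∘ φ` with
`β(a) ⊆ b` induces the ring map `s ⊗ r ↦ Sym(β)(s) ⊗ Rees(α)(r)`. -/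
def map (w : ψ.comp α = β.comp φ) (h : a ≤ b.comap β) : QSym φ a →+* QSym ψ b :=
  lift φ a ((inl ψ b).comp (symMap β a b h))
    ((inr ψ b).comp (reesMap α (a.comap φ) (b.comap ψ) (comap_le_comap φ a ψ b α β w h)))
    (by
      have h₀ := comap_le_comap φ a ψ b α β w h
      have e : (symMap β a b h).comp (symMap φ (a.comap φ) a le_rfl) =
          (symMap ψ (b.comap ψ) b le_rfl).comp (symMap α (a.comap φ) (b.comap ψ) h₀) := by
        refine sym_hom_ext (fun r => ?_) (fun x => ?_)
        · simpa using congrArg (algebraMap B (SymmetricAlgebra B b)) (RingHom.congr_fun w r).symm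
        · simp only [RingHom.comp_apply, symMap_ι]
          congr 1
          exact Subtype.ext (RingHom.congr_fun w x).symm
      rw [RingHom.comp_assoc, e, ← RingHom.comp_assoc, inl_comp_symMap, RingHom.comp_assoc,
        RingHom.comp_assoc, symToRees_natural])

@[simp]
lemma map_inl (w : ψ.comp α = β.comp φ) (h : a ≤ b.comap β) (s : SymmetricAlgebra A a) :
    map φ a ψ b α β w h (inl φ a s) = inl ψ b (symMap β a b h s) := by
  simp [map]

@[simp]
lemma map_inr (w : ψ.comp α = β.comp φ) (h : a ≤ b.comap β) (r : reesAlgebra (a.comap φ)) :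
    map φ a ψ b α β w h (inr φ a r) =
      inr ψ b (reesMap α _ _ (comap_le_comap φ a ψ b α β w h) r) := by
  simp [map]

@[simp]
lemma map_scalar (w : ψ.comp α = β.comp φ) (h : a ≤ b.comap β) (x : A) :
    map φ a ψ b α β w h (scalar φ a x) = scalar ψ b (β x) := by
  simp [scalar]

variable {φ a ψ b χ c α β γ δ}

lemma map_comp (w : ψ.comp α = β.comp φ) (h : a ≤ b.comap β) (w' : χ.comp γ = δ.comp ψ)
    (h' : b ≤ c.comap δ) (w'' : χ.comp (γ.comp α) = (δ.comp β).comp φ)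
    (h'' : a ≤ c.comap (δ.comp β)) :
    (map ψ b χ c γ δ w' h').comp (map φ a ψ b α β w h) =
      map φ a χ c (γ.comp α) (δ.comp β) w'' h'' := by
  refine hom_ext ?_ ?_
  · refine RingHom.ext fun s => ?_
    simp only [RingHom.comp_apply, map_inl]
    rw [← symMap_comp β δ a b c h h' h'']; rfl
  · refine RingHom.ext fun r => ?_
    simp only [RingHom.comp_apply, map_inr]
    rw [← reesMap_comp α γ _ _ _ (comap_le_comap φ a ψ b α β w h)
      (comap_le_comap ψ b χ c γ δ w' h')]; rfl

lemma map_map_apply {α' : R →+* T} {β' : A →+* C}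
    (w : ψ.comp α = β.comp φ) (h : a ≤ b.comap β) (w' : χ.comp γ = δ.comp ψ)
    (h' : b ≤ c.comap δ) (w'' : χ.comp α' = β'.comp φ) (h'' : a ≤ c.comap β')
    (e₁ : γ.comp α = α') (e₂ : δ.comp β = β') (t : QSym φ a) :
    map ψ b χ c γ δ w' h' (map φ a ψ b α β w h t) = map φ a χ c α' β' w'' h'' t := by
  subst e₁ e₂
  exact RingHom.congr_fun (map_comp w h w' h' w'' h'') t

/-- Two composites of functoriality maps agree if the underlying ring maps do. -/
lemma map_map_eq {S' B' : Type u} [CommRing S'] [CommRing B'] {ψ' : S' →+* B'} {b' : Ideal B'}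
    {α' : R →+* S'} {β' : A →+* B'} {γ' : S' →+* T} {δ' : B' →+* C}
    (w : ψ.comp α = β.comp φ) (h : a ≤ b.comap β) (w' : χ.comp γ = δ.comp ψ)
    (h' : b ≤ c.comap δ) (v : ψ'.comp α' = β'.comp φ) (k : a ≤ b'.comap β')
    (v' : χ.comp γ' = δ'.comp ψ') (k' : b' ≤ c.comap δ')
    (e₁ : γ.comp α = γ'.comp α') (e₂ : δ.comp β = δ'.comp β') (t : QSym φ a) :
    map ψ b χ c γ δ w' h' (map φ a ψ b α β w h t) =
      map ψ' b' χ c γ' δ' v' k' (map φ a ψ' b' α' β' v k t) := by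
  have w'' : χ.comp (γ.comp α) = (δ.comp β).comp φ := by
    rw [← RingHom.comp_assoc, w', RingHom.comp_assoc, w, RingHom.comp_assoc]
  have h'' : a ≤ c.comap (δ.comp β) := h.trans (Ideal.comap_mono h')
  have := RingHom.congr_fun (map_comp w h w' h' w'' h'') t
  have := RingHom.congr_fun (map_comp v k v' k' (e₁ ▸ e₂ ▸ w'') (e₂ ▸ h'')) t
  simp_all

end Map

end QSym

end Local

/- The sheaf of quasi-symmetric algebras -/

section Geometric

variable {X Y M N : Scheme.{u}}

/-- Sections over `U` of the ideal sheaf `𝒥_{Y,X}` of a closed immersion `f : Y → X`: the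
functions on `U` that vanish on `Y`. -/
def idealSections (f : Y ⟶ X) (U : X.Opens) : Ideal Γ(X, U) :=
  RingHom.ker (f.app U).hom

lemma idealSections_le_comap_map (f : Y ⟶ X) {U V : X.Opens} (h : V ≤ U) :
    idealSections f U ≤ (idealSections f V).comap (X.presheaf.map (homOfLE h).op).hom := by
  intro s hs
  have hs' : (f.app U).hom s = 0 := hs
  change (f.app V).hom ((X.presheaf.map (homOfLE h).op).hom s) = 0
  have := ConcreteCategory.congr_hom (f.naturality (homOfLE h).op) s
  refine Eq.trans this ?_
  change (Y.presheaf.map _).hom ((f.app U).hom s) = 0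
  rw [hs', map_zero]

/-- The stalk at `x` of the ideal sheaf `𝒥_{Y,X}`, as an ideal of the local ring of `X` at `x`:
the germs at `x` of sections of `𝒥_{Y,X}`. -/
def idealStalk (f : Y ⟶ X) (x : X) : Ideal (X.presheaf.stalk x) where
  carrier := {a | ∃ (U : X.Opens) (hx : x ∈ U) (s : Γ(X, U)),
    s ∈ idealSections f U ∧ (X.presheaf.germ U x hx).hom s = a}
  zero_mem' := ⟨⊤, trivial, 0, zero_mem _, map_zero _⟩
  add_mem' := by
    rintro _ _ ⟨U₁, h₁, s₁, m₁, rfl⟩ ⟨U₂, h₂, s₂, m₂, rfl⟩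
    refine ⟨U₁ ⊓ U₂, ⟨h₁, h₂⟩,
      (X.presheaf.map (homOfLE inf_le_left).op).hom s₁ +
        (X.presheaf.map (homOfLE inf_le_right).op).hom s₂,
      add_mem (idealSections_le_comap_map f inf_le_left m₁)
        (idealSections_le_comap_map f inf_le_right m₂), ?_⟩
    rw [map_add]
    exact congrArg₂ (· + ·)
      (X.presheaf.germ_res_apply (homOfLE inf_le_left) x _ s₁)
      (X.presheaf.germ_res_apply (homOfLE inf_le_right) x _ s₂)
  smul_mem' := by
    rintro b _ ⟨U₁, h₁, s₁, m₁, rfl⟩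
    obtain ⟨U₂, h₂, s₂, rfl⟩ := X.presheaf.exists_germ_eq b
    refine ⟨U₁ ⊓ U₂, ⟨h₁, h₂⟩,
      (X.presheaf.map (homOfLE inf_le_right).op).hom s₂ *
        (X.presheaf.map (homOfLE inf_le_left).op).hom s₁,
      Ideal.mul_mem_left _ _ (idealSections_le_comap_map f inf_le_left m₁), ?_⟩
    rw [map_mul]
    exact congrArg₂ (· * ·)
      (X.presheaf.germ_res_apply (homOfLE inf_le_right) x _ s₂)
      (X.presheaf.germ_res_apply (homOfLE inf_le_left) x _ s₁)

lemma idealSections_le_comap_germ (f : Y ⟶ X) (U : X.Opens) (x : X) (hx : x ∈ U) :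
    idealSections f U ≤ (idealStalk f x).comap (X.presheaf.germ U x hx).hom :=
  fun s hs => ⟨U, hx, s, hs, rfl⟩

/-- The inverse image of `𝒥_{Y,X}(i⁻¹V)` in `Γ(M, V)` is `𝒥_{Y,M}(V)`. -/
lemma comap_idealSections (f : Y ⟶ X) (i : X ⟶ M) (V : M.Opens) :
    (idealSections f (i ⁻¹ᵁ V)).comap (i.app V).hom = idealSections (f ≫ i) V := by
  refine Ideal.ext fun r => ?_
  simp only [idealSections, RingHom.mem_ker, Ideal.mem_comap, Scheme.Hom.comp_app]
  rfl

/-- The inverse image of `𝒥_{Y,X,x}` in the local ring of `M` at `i(x)` is the stalk of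
`𝒥_{Y,M}` there. -/
lemma comap_idealStalk (f : Y ⟶ X) (i : X ⟶ M) [IsClosedImmersion i] (x : X) :
    (idealStalk f x).comap (i.stalkMap x).hom = idealStalk (f ≫ i) (i x) := by
  refine le_antisymm (fun m hm => ?_) ?_
  · obtain ⟨V, hV, r, rfl⟩ := M.presheaf.exists_germ_eq m
    obtain ⟨U, hU, s, hs, e⟩ := hm
    have e' : X.presheaf.germ U x hU s = X.presheaf.germ (i ⁻¹ᵁ V) x hV (i.app V r) :=
      e.trans (ConcreteCategory.congr_hom (i.germ_stalkMap V x hV) r)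
    obtain ⟨W, hW, k₁, k₂, e''⟩ := X.presheaf.germ_eq x hU hV _ _ e'
    obtain ⟨V', rfl⟩ : ∃ V' : M.Opens, i ⁻¹ᵁ V' = W := by
      obtain ⟨V', hV', hVW⟩ := i.isClosedEmbedding.isInducing.isOpen_iff.mp W.2
      exact ⟨⟨V', hV'⟩, Opens.ext hVW⟩
    have hx : i x ∈ V ⊓ V' := ⟨hV, hW⟩
    have l : i ⁻¹ᵁ (V ⊓ V') ≤ i ⁻¹ᵁ V' := i.preimage_mono inf_le_right
    refine ⟨V ⊓ V', hx, (M.presheaf.map (homOfLE inf_le_left).op).hom r, ?_,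
      M.presheaf.germ_res_apply (homOfLE inf_le_left) (i x) hx r⟩
    rw [← comap_idealSections]
    have t₁ := idealSections_le_comap_map f l (idealSections_le_comap_map f k₁.le hs)
    have t₂ : (i.app (V ⊓ V')).hom ((M.presheaf.map (homOfLE inf_le_left).op).hom r) =
        (X.presheaf.map (homOfLE l).op).hom ((X.presheaf.map k₁.op).hom s) := by
      refine (ConcreteCategory.congr_hom (i.naturality (homOfLE inf_le_left).op) r).trans ?_
      refine Eq.trans ?_ (congrArg (X.presheaf.map (homOfLE l).op).hom e'').symm
      exact ConcreteCategory.congr_hom (X.presheaf.map_comp k₂.op (homOfLE l).op) (i.app V r)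
    refine Ideal.mem_comap.mpr ?_
    rw [t₂]
    exact t₁
  · rintro _ ⟨V, hV, r, hr, rfl⟩
    rw [← comap_idealSections] at hr
    exact ⟨i ⁻¹ᵁ V, hV, _, hr, (ConcreteCategory.congr_hom (i.germ_stalkMap V x hV) r).symm⟩

/-- For `V` open in `M`, the quasi-symmetric algebra of `𝒥_{Y,X}(i⁻¹V)` relative to
`Γ(M, V) → Γ(X, i⁻¹V)`. -/
abbrev QSymOpen (f : Y ⟶ X) (i : X ⟶ M) (V : M.Opens) : Type u :=
  QSym (i.app V).hom (idealSections f (i ⁻¹ᵁ V))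

/-- For `x ∈ X`, the quasi-symmetric algebra of the stalk of `𝒥_{Y,X}` at `x` relative to the
map of local rings `𝒪_{M,i(x)} → 𝒪_{X,x}`. -/
abbrev QSymStalk (f : Y ⟶ X) (i : X ⟶ M) (x : X) : Type u :=
  QSym (i.stalkMap x).hom (idealStalk f x)

/-- The germ at `x` of an element of the quasi-symmetric algebra over `V`. -/
def qsymGerm (f : Y ⟶ X) (i : X ⟶ M) (V : M.Opens) (x : X) (hx : i x ∈ V) :
    QSymOpen f i V →+* QSymStalk f i x :=
  QSym.map _ _ _ _ (M.presheaf.germ V (i x) hx).hom (X.presheaf.germ (i ⁻¹ᵁ V) x hx).hom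
    (congrArg CommRingCat.Hom.hom (i.germ_stalkMap V x hx))
    (idealSections_le_comap_germ f _ x hx)

/-- Restriction of the quasi-symmetric algebra over `V` to a smaller open set. -/
def qsymRes (f : Y ⟶ X) (i : X ⟶ M) {V W : M.Opens} (h : W ≤ V) :
    QSymOpen f i V →+* QSymOpen f i W :=
  QSym.map _ _ _ _ (M.presheaf.map (homOfLE h).op).hom
    (X.presheaf.map (homOfLE (i.preimage_mono h)).op).hom
    (by
      rw [← CommRingCat.hom_comp, ← CommRingCat.hom_comp]
      exact congrArg CommRingCat.Hom.hom (i.naturality (homOfLE h).op))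
    (idealSections_le_comap_map f _)

lemma qsymGerm_res (f : Y ⟶ X) (i : X ⟶ M) {V W : M.Opens} (h : W ≤ V) (x : X)
    (hx : i x ∈ W) (t : QSymOpen f i V) :
    qsymGerm f i W x hx (qsymRes f i h t) = qsymGerm f i V x (h hx) t := by
  have eM : (M.presheaf.germ W (i x) hx).hom.comp (M.presheaf.map (homOfLE h).op).hom =
      (M.presheaf.germ V (i x) (h hx)).hom :=
    congrArg CommRingCat.Hom.hom (M.presheaf.germ_res (homOfLE h) (i x) hx)
  have eX : (X.presheaf.germ (i ⁻¹ᵁ W) x hx).hom.comp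
      (X.presheaf.map (homOfLE (i.preimage_mono h)).op).hom =
      (X.presheaf.germ (i ⁻¹ᵁ V) x (h hx)).hom :=
    congrArg CommRingCat.Hom.hom (X.presheaf.germ_res (homOfLE (i.preimage_mono h)) x hx)
  exact QSym.map_map_apply _ _ _ _ _ _ eM eX t

/-- A function `s` on `U` with `s(x)` in the quasi-symmetric algebra at `x` is given by a single
element `t` of the quasi-symmetric algebra over some open `V ⊆ M` with `U ⊆ i⁻¹V`. -/
def qsymPrelocal (f : Y ⟶ X) (i : X ⟶ M) :
    TopCat.PrelocalPredicate (X := X.toTopCat) (fun x => QSymStalk f i x) where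
  pred {U} s := ∃ (V : M.Opens) (hV : ∀ x : U, i x.1 ∈ V) (t : QSymOpen f i V),
    ∀ x : U, s x = qsymGerm f i V x.1 (hV x) t
  res k s h := by
    obtain ⟨V, hV, t, ht⟩ := h
    exact ⟨V, fun x => hV (k x), t, fun x => ht (k x)⟩

/-- The local predicate whose sections form the sheaf associated with the local construction. -/
def qsymLocal (f : Y ⟶ X) (i : X ⟶ M) :
    TopCat.LocalPredicate (X := X.toTopCat) (fun x => QSymStalk f i x) :=
  (qsymPrelocal f i).sheafify

/-- The ring of sections over `U` of the sheaf `qSym_{X ⊂ M}(𝒥_{Y,X})`: functions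
`x ↦ s(x) ∈ qSym_{𝒪_{M,i(x)} → 𝒪_{X,x}}(𝒥_{Y,X,x})` that locally come from elements of the
quasi-symmetric algebras over open subsets of `M`. -/
def qsymSections (f : Y ⟶ X) (i : X ⟶ M) (U : X.Opens) :
    Subring (∀ x : U, QSymStalk f i x.1) where
  carrier := {s | (qsymLocal f i).pred s}
  zero_mem' := TopCat.PrelocalPredicate.sheafifyOf
    ⟨⊤, fun _ => trivial, 0, fun x => (map_zero (qsymGerm f i ⊤ x.1 trivial)).symm⟩
  one_mem' := TopCat.PrelocalPredicate.sheafifyOf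
    ⟨⊤, fun _ => trivial, 1, fun x => (map_one (qsymGerm f i ⊤ x.1 trivial)).symm⟩
  add_mem' ha hb :=
    TopCat.PrelocalPredicate.sheafify_inductionOn₂' (qsymPrelocal f i) (qsymPrelocal f i)
      (qsymPrelocal f i) (fun {x} a b => (a + b : QSymStalk f i x))
      (by
        rintro U V a b ⟨V₁, h₁, t₁, e₁⟩ ⟨V₂, h₂, t₂, e₂⟩
        refine ⟨V₁ ⊓ V₂, fun x => ⟨h₁ ⟨x, x.2.1⟩, h₂ ⟨x, x.2.2⟩⟩,
          qsymRes f i inf_le_left t₁ + qsymRes f i inf_le_right t₂, fun x => ?_⟩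
        refine Eq.trans ?_ (map_add _ _ _).symm
        exact congrArg₂ (· + ·)
          ((e₁ ⟨x, x.2.1⟩).trans (qsymGerm_res f i inf_le_left x.1 _ t₁).symm)
          ((e₂ ⟨x, x.2.2⟩).trans (qsymGerm_res f i inf_le_right x.1 _ t₂).symm)) ha hb
  mul_mem' ha hb :=
    TopCat.PrelocalPredicate.sheafify_inductionOn₂' (qsymPrelocal f i) (qsymPrelocal f i)
      (qsymPrelocal f i) (fun {x} a b => (a * b : QSymStalk f i x))
      (by
        rintro U V a b ⟨V₁, h₁, t₁, e₁⟩ ⟨V₂, h₂, t₂, e₂⟩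
        refine ⟨V₁ ⊓ V₂, fun x => ⟨h₁ ⟨x, x.2.1⟩, h₂ ⟨x, x.2.2⟩⟩,
          qsymRes f i inf_le_left t₁ * qsymRes f i inf_le_right t₂, fun x => ?_⟩
        refine Eq.trans ?_ (map_mul _ _ _).symm
        exact congrArg₂ (· * ·)
          ((e₁ ⟨x, x.2.1⟩).trans (qsymGerm_res f i inf_le_left x.1 _ t₁).symm)
          ((e₂ ⟨x, x.2.2⟩).trans (qsymGerm_res f i inf_le_right x.1 _ t₂).symm)) ha hb
  neg_mem' ha :=
    TopCat.PrelocalPredicate.sheafify_inductionOn' (qsymPrelocal f i)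
      (fun {x} a => (-a : QSymStalk f i x))
      (by
        rintro U a ⟨V, h, t, e⟩
        exact ⟨V, h, -t, fun x => by rw [map_neg, ← e x]⟩) ha

/-- The presheaf of rings `U ↦ qsymSections f i U`, with restriction of functions. -/
def qsymPresheaf (f : Y ⟶ X) (i : X ⟶ M) : TopCat.Presheaf CommRingCat.{u} X.toTopCat where
  obj U := CommRingCat.of (qsymSections f i U.unop)
  map {U V} k := CommRingCat.ofHom
    { toFun := fun s => ⟨fun x => s.1 (k.unop x), (qsymLocal f i).res k.unop s.1 s.2⟩
      map_zero' := rfl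
      map_one' := rfl
      map_add' := fun _ _ => rfl
      map_mul' := fun _ _ => rfl }

/-- The sheaf of rings `qSym_{X ⊂ M}(𝒥_{Y,X}) = Sym(𝒥_{Y,X}) ⊗_{Sym(𝒥_{Y,M})} Rees(𝒥_{Y,M})` on
`X`: the sheaf associated with `V ↦ qSym_{Γ(M, V) → Γ(X, i⁻¹V)}(𝒥_{Y,X}(i⁻¹V))`. Its stalk at `x`
is `qSym_{𝒪_{M,i(x)} → 𝒪_{X,x}}(𝒥_{Y,X,x})`, as symmetric algebras, Rees algebras and tensor
products commute with filtered colimits. -/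
def qsymSheaf (f : Y ⟶ X) (i : X ⟶ M) : TopCat.Sheaf CommRingCat.{u} X.toTopCat :=
  ⟨qsymPresheaf f i,
    (TopCat.Presheaf.isSheaf_iff_isSheaf_comp (forget CommRingCat) _).mpr
      (TopCat.Presheaf.isSheaf_of_iso
        (F := TopCat.subpresheafToTypes (qsymLocal f i).toPrelocalPredicate)
        (NatIso.ofComponents (fun _ => Iso.refl _) (by cat_disch))
        (TopCat.subpresheafToTypes.isSheaf (qsymLocal f i)))⟩

lemma qsymPrelocal_scalar (f : Y ⟶ X) (i : X ⟶ M) (V : M.Opens) (U : X.Opens)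
    (h : U ≤ i ⁻¹ᵁ V) (r : Γ(X, i ⁻¹ᵁ V)) :
    (qsymPrelocal f i).pred (U := U) (fun x =>
      QSym.scalar (i.stalkMap x.1).hom (idealStalk f x.1)
        ((X.presheaf.germ (i ⁻¹ᵁ V) x.1 (h x.2)).hom r)) :=
  ⟨V, fun x => h x.2, QSym.scalar _ _ r, fun _ => (QSym.map_scalar _ _ _ _ _ _ _ _ r).symm⟩

/-- The structure map `𝒪_X(U) → qSym_{X ⊂ M}(𝒥_{Y,X})(U)`, for a closed immersion `i : X → M`. -/
def qsymScalar (f : Y ⟶ X) (i : X ⟶ M) [IsClosedImmersion i] (U : X.Opens) :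
    Γ(X, U) →+* qsymSections f i U :=
  (RingHom.codRestrict (RingHom.pi fun x : U =>
    (QSym.scalar (i.stalkMap x.1).hom (idealStalk f x.1)).comp
      (X.presheaf.germ U x.1 x.2).hom) (qsymSections f i U) (fun r => by
        obtain ⟨V, hV, hVU⟩ := i.isClosedEmbedding.isInducing.isOpen_iff.mp U.2
        obtain rfl : i ⁻¹ᵁ (⟨V, hV⟩ : M.Opens) = U := Opens.ext hVU
        exact TopCat.PrelocalPredicate.sheafifyOf
          (qsymPrelocal_scalar f i ⟨V, hV⟩ (i ⁻¹ᵁ ⟨V, hV⟩) le_rfl r)))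

/-- The structure map `𝒪_X → qSym_{X ⊂ M}(𝒥_{Y,X})`, for a closed immersion `i : X → M`. -/
def qsymStructure (f : Y ⟶ X) (i : X ⟶ M) [IsClosedImmersion i] :
    X.sheaf ⟶ qsymSheaf f i :=
  ⟨{ app := fun U => CommRingCat.ofHom (qsymScalar f i U.unop)
     naturality := fun U V k => by
       refine CommRingCat.hom_ext (RingHom.ext fun r => Subtype.ext (funext fun x => ?_))
       exact congrArg (QSym.scalar (i.stalkMap x.1).hom (idealStalk f x.1))
         (ConcreteCategory.congr_hom (X.presheaf.germ_res k.unop x.1 x.2) r) }⟩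

/-- The `𝒪_X`-algebra `qSym_{X ⊂ M}(𝒥_{Y,X})`: a sheaf of commutative rings under `𝒪_X`. -/
def qsymAlgebra (f : Y ⟶ X) (i : X ⟶ M) [IsClosedImmersion i] : Under X.sheaf :=
  Under.mk (qsymStructure f i)

/-- The degree `d` part of `qSym_{X ⊂ M}(𝒥_{Y,X})` over `U`. -/
def qsymDegree (f : Y ⟶ X) (i : X ⟶ M) (U : X.Opens) (d : ℕ) :
    AddSubgroup (qsymSections f i U) where
  carrier := {s | ∀ x : U, s.1 x ∈ QSym.degree (i.stalkMap x.1).hom (idealStalk f x.1) d}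
  zero_mem' := fun _ => zero_mem _
  add_mem' := fun ha hb x => add_mem (ha x) (hb x)
  neg_mem' := fun ha x => neg_mem (ha x)

/- Functoriality in the ambient scheme -/

/-- The map of local rings `𝒪_{M,i(x)} → 𝒪_{N,j(x)}` induced by `π`, where `π(j(x)) = i(x)`. -/
def stalkHom (i : X ⟶ M) (j : X ⟶ N) (π : N ⟶ M) (h : j ≫ π = i) 
    (x : X) : M.presheaf.stalk (i x) →+* N.presheaf.stalk (j x) :=
  (M.presheaf.stalkSpecializes (specializes_of_eq (by rw [← h]; rfl : π (j x) = i x)) ≫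
    π.stalkMap (j x)).hom

lemma stalkMap_comp_stalkHom (i : X ⟶ M) (j : X ⟶ N) (π : N ⟶ M) (h : j ≫ π = i) 
    (x : X) :
    (j.stalkMap x).hom.comp (stalkHom i j π h x) = (RingHom.id _).comp (i.stalkMap x).hom := by
  subst h
  have key : (M.presheaf.stalkSpecializes (specializes_refl (π (j x))) ≫ π.stalkMap (j x)) ≫
      j.stalkMap x = (j ≫ π).stalkMap x := by
    rw [TopCat.Presheaf.stalkSpecializes_refl, Category.id_comp]
    exact (Scheme.Hom.stalkMap_comp j π x).symm
  exact congrArg CommRingCat.Hom.hom key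

/-- The map `qSym` at `x` relative to `M` → `qSym` at `x` relative to `N` induced by `π`. -/
def qsymStalkMap (f : Y ⟶ X) (i : X ⟶ M) (j : X ⟶ N) (π : N ⟶ M) (h : j ≫ π = i) 
    (x : X) : QSymStalk f i x →+* QSymStalk f j x :=
  QSym.map _ _ _ _ (stalkHom i j π h x) (RingHom.id _) (stalkMap_comp_stalkHom i j π h x) le_rfl

lemma preimage_le (i : X ⟶ M) (j : X ⟶ N) (π : N ⟶ M) (h : j ≫ π = i) 
    (V : M.Opens) : j ⁻¹ᵁ (π ⁻¹ᵁ V) ≤ i ⁻¹ᵁ V := by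
  rw [← h]; exact le_rfl

/-- The map `qSym` over `V ⊆ M` → `qSym` over `π⁻¹V ⊆ N` induced by `π`. -/
def qsymOpenMap (f : Y ⟶ X) (i : X ⟶ M) (j : X ⟶ N) (π : N ⟶ M) (h : j ≫ π = i) 
    (V : M.Opens) : QSymOpen f i V →+* QSymOpen f j (π ⁻¹ᵁ V) :=
  QSym.map _ _ _ _ (π.app V).hom (X.presheaf.map (homOfLE (preimage_le i j π h V)).op).hom
    (by
      subst h
      have key : π.app V ≫ j.app (π ⁻¹ᵁ V) = (j ≫ π).app V ≫
          X.presheaf.map (homOfLE (preimage_le (j ≫ π) j π rfl V)).op := by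
        rw [Scheme.Hom.comp_app]
        exact (Category.comp_id _).symm.trans (congrArg _ (X.presheaf.map_id _).symm)
      exact congrArg CommRingCat.Hom.hom key)
    (idealSections_le_comap_map f _)

lemma qsymGerm_map (f : Y ⟶ X) (i : X ⟶ M) (j : X ⟶ N) (π : N ⟶ M) (h : j ≫ π = i) 
    (V : M.Opens) (x : X) (hx : i x ∈ V) (hx' : j x ∈ π ⁻¹ᵁ V)
    (t : QSymOpen f i V) :
    qsymStalkMap f i j π h x (qsymGerm f i V x hx t) =
      qsymGerm f j (π ⁻¹ᵁ V) x hx' (qsymOpenMap f i j π h V t) := by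
  refine QSym.map_map_eq _ _ _ _ _ _ _ _ ?_ ?_ t
  · subst h
    have key : M.presheaf.germ V (π (j x)) hx ≫
        M.presheaf.stalkSpecializes (specializes_refl (π (j x))) ≫ π.stalkMap (j x) =
        π.app V ≫ N.presheaf.germ (π ⁻¹ᵁ V) (j x) hx' := by
      rw [TopCat.Presheaf.stalkSpecializes_refl, Category.id_comp]
      exact π.germ_stalkMap V (j x) hx'
    exact congrArg CommRingCat.Hom.hom key
  · exact congrArg CommRingCat.Hom.hom
      (X.presheaf.germ_res (homOfLE (preimage_le i j π h V)) x hx').symm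

/-- The map on sections over `U`: apply the maps of quasi-symmetric algebras pointwise. -/
def qsymSectionsMap (f : Y ⟶ X) (i : X ⟶ M) (j : X ⟶ N) (π : N ⟶ M) (h : j ≫ π = i) 
    (U : X.Opens) : qsymSections f i U →+* qsymSections f j U :=
  RingHom.codRestrict
    ((RingHom.pi fun x : U =>
      (qsymStalkMap f i j π h x.1).comp (Pi.evalRingHom (fun x : U => QSymStalk f i x.1) x)).comp
      (qsymSections f i U).subtype) (qsymSections f j U)
    (fun s x => by
      obtain ⟨W, hxW, k, V, hV, t, ht⟩ := s.2 x
      have hV' : ∀ y : W, j y.1 ∈ π ⁻¹ᵁ V := fun y => by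
        have := hV y
        rw [← h] at this
        exact this
      exact ⟨W, hxW, k, π ⁻¹ᵁ V, hV', qsymOpenMap f i j π h V t, fun y =>
        (congrArg (qsymStalkMap f i j π h y.1) (ht y)).trans
          (qsymGerm_map f i j π h V y.1 (hV y) (hV' y) t)⟩)

/-- The map of sheaves of rings `qSym_{X ⊂ M}(𝒥_{Y,X}) → qSym_{X ⊂ N}(𝒥_{Y,X})`. -/
def qsymSheafMap (f : Y ⟶ X) (i : X ⟶ M) (j : X ⟶ N) (π : N ⟶ M) (h : j ≫ π = i) :
    qsymSheaf f i ⟶ qsymSheaf f j :=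
  ⟨{ app := fun U => CommRingCat.ofHom (qsymSectionsMap f i j π h U.unop)
     naturality := fun _ _ _ => rfl }⟩

/-- The map of `𝒪_X`-algebras `qSym_{X ⊂ M}(𝒥_{Y,X}) → qSym_{X ⊂ N}(𝒥_{Y,X})` induced by a
morphism `π : N → M` compatible with the closed immersions `i : X → M` and `j : X → N`. -/
def qsymAlgebraMap (f : Y ⟶ X) (i : X ⟶ M) (j : X ⟶ N) (π : N ⟶ M) (h : j ≫ π = i) 
    [IsClosedImmersion i] [IsClosedImmersion j] :
    qsymAlgebra f i ⟶ qsymAlgebra f j :=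
  Under.homMk (qsymSheafMap f i j π h) (by
    refine Sheaf.hom_ext (NatTrans.ext (funext fun U => CommRingCat.hom_ext (RingHom.ext fun r =>
      Subtype.ext (funext fun x => ?_))))
    exact QSym.map_scalar _ _ _ _ _ _ (stalkMap_comp_stalkHom i j π h x.1) le_rfl _)

end Geometric

end QuasiSym

end

/-! Work at a point of X, with local rings R of M, S of N and A of X, surjections φ : R → A with
kernel K and ψ : S → A, and α : R → S with ψ ∘ α = φ. Put I = φ⁻¹(a).

Since Sym_R(I) → Rees_R(I) is onto, both quasi-symmetric algebras are quotients of Sym_A(a), and the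
comparison map respects these quotient maps (`QSym.inl_surjective`, `QSym.map_id_inl`). This gives
surjectivity, and it identifies each degree d part with the image of Sym^d. Only injectivity needs
smoothness.

As φ is onto, the algebra is also Rees_R(I) modulo the elements that vanish in A: K in degree 0 and
K t in degree 1. The ideal they generate is K I^(d-1) in degree d (`QSym.inr_eq_zero_iff`).
Injectivity thus says that α(c) ∈ (ker ψ) J^(d-1), with J = ψ⁻¹(a), forces c ∈ K I^(d-1). Formal
smoothness lifts ψ to σ : S → R/K^d over R. Applying σ puts c in K I^(d-1) + K^d, which is K I^(d-1)
because K ⊆ I (`QSym.mem_ker_mul_pow_of_map_mem`).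

Sections of the sheaves are functions into these stalk algebras, so injectivity is checked
pointwise. Local preimages of a section come from Sym and glue by injectivity. -/

namespace QuasiSym

/-! ### Symmetric and Rees algebras of an ideal -/

section Local

variable {R S A B : Type u} [CommRing R] [CommRing S] [CommRing A] [CommRing B]

/-- A homogeneous element of degree `q` of the Rees algebra comes from a homogeneous element of
degree `q` of the symmetric algebra. -/
lemma exists_symToRees_eq_monomial (I : Ideal R) (q : ℕ) {c : R} (hc : c ∈ I ^ q) :
    ∃ z ∈ LinearMap.range (SymmetricAlgebra.ι R I) ^ q,
      (symToRees I z : Polynomial R) = Polynomial.monomial q c := by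
  induction q generalizing c with
  | zero =>
    exact ⟨algebraMap R _ c, by rw [pow_zero]; exact Submodule.algebraMap_mem c,
      by rw [AlgHom.commutes]; rfl⟩
  | succ q ih =>
    rw [pow_succ'] at hc
    induction hc using Submodule.mul_induction_on' with
    | mem_mul_mem x hx y hy =>
      obtain ⟨z, hz, e⟩ := ih hy
      refine ⟨SymmetricAlgebra.ι R I ⟨x, hx⟩ * z, ?_, ?_⟩
      · rw [pow_succ']
        exact Submodule.mul_mem_mul ⟨_, rfl⟩ hz
      · rw [map_mul, Subalgebra.coe_mul, e, symToRees_ι, Polynomial.monomial_mul_monomial,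
          add_comm]
    | add x _ y _ hx hy =>
      obtain ⟨z, hz, e⟩ := hx
      obtain ⟨w, hw, e'⟩ := hy
      exact ⟨z + w, add_mem hz hw, by rw [map_add, Subalgebra.coe_add, e, e', map_add]⟩

lemma symToRees_surjective (I : Ideal R) : Function.Surjective (symToRees I) := by
  intro p
  choose z _ hz using fun q => exists_symToRees_eq_monomial I q (p.2 q)
  refine ⟨∑ q ∈ (p : Polynomial R).support, z q, Subtype.ext ?_⟩
  rw [map_sum, AddSubmonoidClass.coe_finsetSum]
  simp_rw [hz]
  exact (Polynomial.as_sum_support _).symm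

lemma symMap_id (I : Ideal R) (h : I ≤ I.comap (RingHom.id R)) :
    symMap (RingHom.id R) I I h = RingHom.id _ :=
  sym_hom_ext (fun r => by simp) (fun x => by simp)

lemma symMap_surjective {φ : R →+* S} {I : Ideal R} {J : Ideal S} (h : I ≤ J.comap φ)
    (hφ : Function.Surjective φ) (hI : ∀ y ∈ J, ∃ x ∈ I, φ x = y) :
    Function.Surjective (symMap φ I J h) := by
  intro z
  induction z using SymmetricAlgebra.induction with
  | algebraMap r =>
    obtain ⟨r, rfl⟩ := hφ r
    exact ⟨algebraMap R _ r, symMap_algebraMap φ I J h r⟩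
  | ι y =>
    obtain ⟨y, hy⟩ := y
    obtain ⟨x, hx, rfl⟩ := hI y hy
    exact ⟨SymmetricAlgebra.ι R I ⟨x, hx⟩, symMap_ι φ I J h ⟨x, hx⟩⟩
  | mul a b ha hb =>
    obtain ⟨a, rfl⟩ := ha
    obtain ⟨b, rfl⟩ := hb
    exact ⟨a * b, map_mul _ _ _⟩
  | add a b ha hb =>
    obtain ⟨a, rfl⟩ := ha
    obtain ⟨b, rfl⟩ := hb
    exact ⟨a + b, map_add _ _ _⟩

/-- Serves to form the quotient of a Rees algebra by `reesIdeal` as an opaque ring of which only the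
kernel is known. -/
lemma exists_ringHom_ker_eq (I : Ideal R) :
    ∃ (B : Type u) (_ : CommRing B) (q : R →+* B), RingHom.ker q = I :=
  ⟨R ⧸ I, inferInstance, Ideal.Quotient.mk I, Ideal.mk_ker⟩

/-- The ideal `⨁ K Iᵈ⁻¹ tᵈ` of the Rees algebra of `I`, with `K` in degree `0`. -/
def reesIdeal (K I : Ideal R) : Ideal (reesAlgebra I) where
  carrier := {r | ∀ d, (r : Polynomial R).coeff d ∈ K * I ^ (d - 1)}
  zero_mem' d := by simp
  add_mem' ha hb d := by
    rw [Subalgebra.coe_add, Polynomial.coeff_add]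
    exact add_mem (ha d) (hb d)
  smul_mem' r k hk d := by
    rw [smul_eq_mul, Subalgebra.coe_mul, Polynomial.coeff_mul]
    refine Ideal.sum_mem _ ?_
    rintro ⟨p, q⟩ e
    rw [← Finset.HasAntidiagonal.mem_antidiagonal.mp e]
    have h := Ideal.mul_mem_mul (r.2 p) (hk q)
    rw [mul_left_comm, ← pow_add] at h
    -- Truncated subtraction still gives (p + q) - 1 ≤ p + (q - 1), with strict inequality possible
    -- only for q = 0.
    exact Ideal.mul_mono_right (Ideal.pow_le_pow_right (by dsimp only; omega)) h

lemma mem_reesIdeal {K I : Ideal R} {r : reesAlgebra I} :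
    r ∈ reesIdeal K I ↔ ∀ d, (r : Polynomial R).coeff d ∈ K * I ^ (d - 1) := Iff.rfl

lemma mk_mem_reesIdeal {K I : Ideal R} {d : ℕ} {c : R}
    (hc : Polynomial.monomial d c ∈ reesAlgebra I) (h : c ∈ K * I ^ (d - 1)) :
    ⟨Polynomial.monomial d c, hc⟩ ∈ reesIdeal K I := by
  intro e
  rw [Polynomial.coeff_monomial]
  split_ifs with hde
  · exact hde ▸ h
  · exact zero_mem _

/-! ### The quasi-symmetric algebra as a quotient of Sym and of Rees -/

namespace QSym

lemma inl_symMap (φ : R →+* A) (a : Ideal A) (z : SymmetricAlgebra R (a.comap φ)) :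
    inl φ a (symMap φ (a.comap φ) a le_rfl z) = inr φ a (symToRees (a.comap φ) z) :=
  RingHom.congr_fun (inl_comp_symMap φ a) z

-- Every Rees factor lifts to Sym_R(I) and can be moved across the tensor sign.
attribute [local instance] symAlgebra reesSymAlgebra in
lemma inl_surjective (φ : R →+* A) (a : Ideal A) : Function.Surjective (inl φ a) := by
  intro t
  have e (t : SymmetricAlgebra A a ⊗[SymmetricAlgebra R (a.comap φ)] reesAlgebra (a.comap φ)) :
      ∃ s, inl φ a s = t := by
    induction t using TensorProduct.induction_on with
    | zero => exact ⟨0, map_zero _⟩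
    | tmul s r =>
      obtain ⟨z, rfl⟩ := symToRees_surjective _ r
      refine ⟨s * symMap φ _ a le_rfl z, ?_⟩
      rw [map_mul, inl_symMap]
      refine (Algebra.TensorProduct.tmul_mul_tmul _ _ _ _).trans ?_
      rw [mul_one, one_mul]
    | add x y hx hy =>
      obtain ⟨x', rfl⟩ := hx
      obtain ⟨y', rfl⟩ := hy
      exact ⟨x' + y', map_add _ _ _⟩
  exact e t

lemma inr_surjective {φ : R →+* A} (a : Ideal A) (hφ : Function.Surjective φ) :
    Function.Surjective (inr φ a) := by
  intro t
  obtain ⟨s, rfl⟩ := inl_surjective φ a t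
  obtain ⟨z, rfl⟩ := symMap_surjective (φ := φ) (I := a.comap φ) (J := a) le_rfl hφ
    (fun y hy => by
      obtain ⟨x, rfl⟩ := hφ y
      exact ⟨x, hy, rfl⟩) s
  exact ⟨_, (inl_symMap φ a z).symm⟩

/-- In degree 0 the element crosses the tensor sign as the scalar φ(c) = 0. In degree d + 1 it is a
sum of products (x t)(y t^d) with x ∈ ker φ, and x t crosses as the degree-one generator of φ(x) =
0. -/
lemma inr_monomial_eq_zero (φ : R →+* A) (a : Ideal A) (d : ℕ) {c : R}
    (hc : c ∈ RingHom.ker φ * a.comap φ ^ (d - 1))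
    (hm : Polynomial.monomial d c ∈ reesAlgebra (a.comap φ)) :
    inr φ a ⟨Polynomial.monomial d c, hm⟩ = 0 := by
  cases d with
  | zero =>
    have h0 : φ c = 0 := by simpa using hc
    have e : (⟨Polynomial.monomial 0 c, hm⟩ : reesAlgebra (a.comap φ)) =
        symToRees _ (algebraMap R _ c) := by rw [AlgHom.commutes]; rfl
    rw [e, ← inl_symMap, symMap_algebraMap, h0, map_zero, map_zero]
  | succ d =>
    have hK : RingHom.ker φ ≤ a.comap φ := Ideal.comap_mono bot_le
    have hle : RingHom.ker φ * a.comap φ ^ d ≤ a.comap φ ^ (d + 1) := by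
      rw [pow_succ']; exact Ideal.mul_mono_left hK
    rw [Nat.add_sub_cancel] at hc
    induction hc using Submodule.mul_induction_on' with
    | mem_mul_mem x hx y hy =>
      have e : (⟨Polynomial.monomial (d + 1) (x * y), hm⟩ : reesAlgebra (a.comap φ)) =
          symToRees _ (SymmetricAlgebra.ι R _ ⟨x, hK hx⟩) *
            ⟨Polynomial.monomial d y, reesAlgebra.monomial_mem.mpr hy⟩ := by
        refine Subtype.ext ?_
        rw [Subalgebra.coe_mul, symToRees_ι, Polynomial.monomial_mul_monomial, add_comm 1 d]
      have h0 : (⟨φ x, hK hx⟩ : a) = 0 := Subtype.ext hx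
      rw [e, map_mul, ← inl_symMap, symMap_ι, h0, map_zero, map_zero, zero_mul]
    | add x hx y hy ihx ihy =>
      have e : (⟨Polynomial.monomial (d + 1) (x + y), hm⟩ : reesAlgebra (a.comap φ)) =
          ⟨Polynomial.monomial (d + 1) x, reesAlgebra.monomial_mem.mpr (hle hx)⟩ +
            ⟨Polynomial.monomial (d + 1) y, reesAlgebra.monomial_mem.mpr (hle hy)⟩ :=
        Subtype.ext (map_add _ _ _)
      rw [e, map_add, ihx, ihy, add_zero]

lemma inr_eq_zero_of_mem (φ : R →+* A) (a : Ideal A) {r : reesAlgebra (a.comap φ)}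
    (hr : r ∈ reesIdeal (RingHom.ker φ) (a.comap φ)) : inr φ a r = 0 := by
  have e : r = ∑ d ∈ (r : Polynomial R).support,
      (⟨Polynomial.monomial d ((r : Polynomial R).coeff d),
        reesAlgebra.monomial_mem.mpr (r.2 d)⟩ : reesAlgebra (a.comap φ)) := by
    refine Subtype.ext ?_
    rw [AddSubmonoidClass.coe_finsetSum]
    exact Polynomial.as_sum_support _
  rw [e, map_sum]
  exact Finset.sum_eq_zero fun d _ => inr_monomial_eq_zero φ a d (hr d) _

/-- For surjective `φ`, a ring map out of the Rees algebra that kills `⨁ (ker φ) Iᵈ⁻¹ tᵈ` factors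
through the quasi-symmetric algebra. -/
lemma exists_comp_inr_eq {φ : R →+* A} (a : Ideal A) (hφ : Function.Surjective φ)
    (q : reesAlgebra (a.comap φ) →+* B)
    (hq : ∀ r ∈ reesIdeal (RingHom.ker φ) (a.comap φ), q r = 0) :
    ∃ F : QSym φ a →+* B, ∀ r, F (inr φ a r) = q r := by
  -- Degree 0 of `reesIdeal` is ker φ, so `q` on scalars factors through A.
  let f₀ : A →+* B :=
    RingHom.liftOfRightInverse φ (Function.surjInv hφ) (Function.rightInverse_surjInv hφ)
      ⟨q.comp (algebraMap R (reesAlgebra (a.comap φ))), fun x hx => hq _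
        (mk_mem_reesIdeal (d := 0) (reesAlgebra.monomial_mem.mpr (by simp)) (by simpa using hx))⟩
  have hf₀ (r : R) : f₀ (φ r) = q (algebraMap R _ r) :=
    RingHom.liftOfRightInverse_comp_apply _ _ _ _ r
  let : Algebra A B := f₀.toAlgebra
  let m (x : a.comap φ) : reesAlgebra (a.comap φ) := symToRees (a.comap φ) (SymmetricAlgebra.ι R (a.comap φ) x)
  -- Degree 1 of `reesIdeal` is again ker φ, the exponent being 1 - 1 = 0. So q(x t) depends only on
  -- φ(x), and the set-theoretic section `g` below yields an A-linear map.
  have hm (x y : a.comap φ) (h : φ x = φ y) : q (m x) = q (m y) := by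
    rw [← sub_eq_zero, ← map_sub, ← map_sub, ← map_sub]
    refine hq _ fun d => ?_
    rw [symToRees_ι]
    refine mk_mem_reesIdeal (reesAlgebra.monomial_mem.mpr (by simpa using (x - y).2)) ?_ d
    simpa [RingHom.mem_ker, sub_eq_zero] using h
  let g (x : a) : a.comap φ := ⟨Function.surjInv hφ x, by
    rw [Ideal.mem_comap, Function.surjInv_eq hφ]; exact x.2⟩
  have hg (x : a) : φ (g x) = x := Function.surjInv_eq hφ _
  let f₁ : a →ₗ[A] B :=
    { toFun := fun x => q (m (g x))
      map_add' := fun x y => by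
        rw [← map_add, ← map_add, ← map_add]
        exact hm _ _ (by simp [hg])
      map_smul' := fun s x => by
        obtain ⟨s, rfl⟩ := hφ s
        rw [Algebra.smul_def, RingHom.algebraMap_toAlgebra, RingHom.id_apply, hf₀, ← map_mul,
          ← Algebra.smul_def, ← map_smul, ← map_smul]
        exact hm _ _ (by simp [hg]) }
  let f := (SymmetricAlgebra.lift f₁).toRingHom
  have h : f.comp (symMap φ (a.comap φ) a le_rfl) = q.comp (symToRees (a.comap φ)).toRingHom := by
    refine sym_hom_ext (fun r => ?_) (fun x => ?_)
    · rw [RingHom.comp_apply, symMap_algebraMap]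
      refine (AlgHom.commutes _ _).trans ((hf₀ r).trans ?_)
      exact congrArg q (AlgHom.commutes (symToRees (a.comap φ)) r).symm
    · rw [RingHom.comp_apply, symMap_ι]
      exact (SymmetricAlgebra.lift_ι_apply f₁ _).trans (hm _ _ (hg _))
  exact ⟨lift φ a f q h, lift_inr φ a f q h⟩

/-- For surjective `φ`, the kernel of `Rees_R(I) → QSym φ a` is `⨁ (ker φ) Iᵈ⁻¹ tᵈ`. -/
lemma inr_eq_zero_iff {φ : R →+* A} (a : Ideal A) (hφ : Function.Surjective φ)
    (r : reesAlgebra (a.comap φ)) :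
    inr φ a r = 0 ↔ r ∈ reesIdeal (RingHom.ker φ) (a.comap φ) := by
  refine ⟨fun h => ?_, inr_eq_zero_of_mem φ a⟩
  -- The quotient by the expected kernel factors through `QSym φ a`, so the actual kernel is no
  -- larger.
  obtain ⟨B, _, q, hq⟩ := exists_ringHom_ker_eq (reesIdeal (RingHom.ker φ) (a.comap φ))
  obtain ⟨F, hF⟩ := exists_comp_inr_eq a hφ q fun x hx => by rwa [← hq, RingHom.mem_ker] at hx
  rw [← hq, RingHom.mem_ker, ← hF, h, map_zero]

/-! ### Injectivity from infinitesimal lifting -/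

section FormallySmooth

variable {φ : R →+* A} {ψ : S →+* A} {α : R →+* S}

/-- If `α : R → S` is formally smooth over `A`, then modulo `(ker φ)ⁿ` the map `ψ : S → A` lifts
to `R`. -/
lemma exists_lift_quotient_pow (hα : α.FormallySmooth) (w : ψ.comp α = φ)
    (hφ : Function.Surjective φ) {n : ℕ} (hn : n ≠ 0) :
    ∃ σ : S →+* R ⧸ RingHom.ker φ ^ n, (∀ r, σ (α r) = Ideal.Quotient.mk _ r) ∧
      ∀ s r, σ s = Ideal.Quotient.mk _ r → φ r = ψ s := by
  let : Algebra R S := α.toAlgebra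
  have : Algebra.FormallySmooth R S := hα
  let : Algebra R A := φ.toAlgebra
  let g : (R ⧸ RingHom.ker φ ^ n) →ₐ[R] A :=
    Ideal.Quotient.liftₐ _ (Algebra.ofId R A) (fun x hx => Ideal.pow_le_self hn hx)
  have hg (r : R) : g (Ideal.Quotient.mk _ r) = φ r := rfl
  have hgs : Function.Surjective g := fun x => (hφ x).imp' _ fun r hr => (hg r).trans hr
  have hker : RingHom.ker (g : (R ⧸ RingHom.ker φ ^ n) →+* A) =
      (RingHom.ker φ).map (Ideal.Quotient.mk _) := by
    refine le_antisymm (fun x hx => ?_) (Ideal.map_le_iff_le_comap.mpr fun x hx => hx)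
    obtain ⟨r, rfl⟩ := Ideal.Quotient.mk_surjective x
    exact Ideal.mem_map_of_mem _ hx
  -- The kernel of R/Kⁿ → A is K/Kⁿ, whose n-th power is zero, so formal smoothness lifts ψ through
  -- this surjection.
  have hnil : IsNilpotent (RingHom.ker (g : (R ⧸ RingHom.ker φ ^ n) →+* A)) :=
    ⟨n, by rw [hker, ← Ideal.map_pow, Ideal.map_quotient_self]; rfl⟩
  let p : S →ₐ[R] A := ⟨ψ, RingHom.congr_fun w⟩
  let σ := Algebra.FormallySmooth.liftOfSurjective p g hgs hnil
  refine ⟨σ, fun r => σ.commutes r, fun s r h => ?_⟩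
  rw [← hg, ← h]
  exact Algebra.FormallySmooth.liftOfSurjective_apply p g hgs hnil s

/-- A lift σ : S → R/K^d of ψ returns α(c) to the class of c and carries preimages of ideals of A
under ψ into their preimages under φ. The error K^d already lies in K I^(d-1). -/
lemma mem_ker_mul_pow_of_map_mem (hα : α.FormallySmooth) (w : ψ.comp α = φ)
    (hφ : Function.Surjective φ) (a : Ideal A) (d : ℕ) {c : R}
    (hc : α c ∈ RingHom.ker ψ * a.comap ψ ^ (d - 1)) :
    c ∈ RingHom.ker φ * a.comap φ ^ (d - 1) := by
  -- For d = 0 both ideals are the bare kernels, and ψ ∘ α = φ suffices.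
  rcases Nat.eq_zero_or_pos d with rfl | hd
  · simpa [← w] using hc
  have hK : RingHom.ker φ ≤ a.comap φ := Ideal.comap_mono bot_le
  obtain ⟨σ, hσα, hσ⟩ := exists_lift_quotient_pow hα w hφ hd.ne'
  -- Used for b = ⊥, where the preimages are the kernels, and for b = a.
  have key (b : Ideal A) : (b.comap ψ).map σ ≤ (b.comap φ).map (Ideal.Quotient.mk _) := by
    refine Ideal.map_le_iff_le_comap.mpr fun s hs => ?_
    obtain ⟨r, hr⟩ := Ideal.Quotient.mk_surjective (σ s)
    rw [Ideal.mem_comap, ← hr]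
    refine Ideal.mem_map_of_mem _ ?_
    rwa [Ideal.mem_comap, hσ s r hr.symm]
  have h₁ : Ideal.Quotient.mk _ c ∈ (RingHom.ker φ * a.comap φ ^ (d - 1)).map
      (Ideal.Quotient.mk (RingHom.ker φ ^ d)) := by
    rw [← hσα, Ideal.map_mul, Ideal.map_pow]
    have := Ideal.mem_map_of_mem σ hc
    rw [Ideal.map_mul, Ideal.map_pow] at this
    exact Ideal.mul_mono (key ⊥) (Ideal.pow_right_mono (key a) _) this
  have h₂ : RingHom.ker φ ^ d ≤ RingHom.ker φ * a.comap φ ^ (d - 1) := by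
    obtain ⟨e, rfl⟩ := Nat.exists_eq_succ_of_ne_zero hd.ne'
    rw [pow_succ']
    exact Ideal.mul_mono_right (Ideal.pow_right_mono hK e)
  obtain ⟨x, hx, e⟩ := (Ideal.mem_map_iff_of_surjective _ Ideal.Quotient.mk_surjective).mp h₁
  rw [← sub_sub_cancel x c]
  exact sub_mem hx (h₂ (Ideal.Quotient.eq.mp e))

/-- Both φ and ψ are onto, so both algebras are explicit quotients of Rees algebras, and vanishing
is tested one coefficient at a time. -/
lemma map_injective_of_formallySmooth (hα : α.FormallySmooth)
    (w : ψ.comp α = (RingHom.id A).comp φ) (hφ : Function.Surjective φ) (a : Ideal A)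
    (h : a ≤ a.comap (RingHom.id A)) :
    Function.Injective (map φ a ψ a α (RingHom.id A) w h) := by
  rw [injective_iff_map_eq_zero]
  intro t ht
  have w' : ψ.comp α = φ := w
  have hψ : Function.Surjective ψ := .of_comp (g := α) (by rw [← RingHom.coe_comp, w']; exact hφ)
  obtain ⟨r, rfl⟩ := inr_surjective a hφ t
  rw [map_inr, inr_eq_zero_iff a hψ, mem_reesIdeal] at ht
  refine inr_eq_zero_of_mem φ a fun d => mem_ker_mul_pow_of_map_mem hα w' hφ a d ?_
  simpa using ht d

end FormallySmooth

/-! ### The grading -/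

variable {φ : R →+* A} {ψ : S →+* A} {α : R →+* S}

/-- A homogeneous Rees factor lifts to a symmetric element of the same degree, and its image in
Sym_A(a) keeps that degree. -/
lemma exists_inl_eq_of_mem_degree (ψ : S →+* A) (a : Ideal A) {d : ℕ} {t : QSym ψ a}
    (ht : t ∈ degree ψ a d) :
    ∃ z ∈ LinearMap.range (SymmetricAlgebra.ι A a) ^ d, inl ψ a z = t := by
  induction ht using AddSubgroup.closure_induction with
  | mem t ht =>
    obtain ⟨p, q, s, r, rfl, hs, ⟨c, hc⟩, rfl⟩ := ht
    obtain ⟨z, hz, e⟩ := exists_symToRees_eq_monomial (a.comap ψ) q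
      (reesAlgebra.monomial_mem.mp (hc ▸ r.2))
    obtain rfl : symToRees _ z = r := Subtype.ext (e.trans hc.symm)
    refine ⟨s * symMap ψ _ a le_rfl z, ?_, by rw [map_mul, inl_symMap]⟩
    rw [pow_add]
    refine Submodule.mul_mem_mul hs ?_
    clear e hc hs
    induction hz using Submodule.pow_induction_on_left' with
    | algebraMap r =>
      rw [symMap_algebraMap, pow_zero]
      exact Submodule.algebraMap_mem _
    | add x y i hx hy ihx ihy => rw [map_add]; exact add_mem ihx ihy
    | mem_mul m hm i x hx ih =>
      obtain ⟨y, rfl⟩ := hm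
      rw [map_mul, Nat.succ_eq_add_one, pow_succ', symMap_ι]
      exact Submodule.mul_mem_mul ⟨_, rfl⟩ ih
  | zero => exact ⟨0, zero_mem _, map_zero _⟩
  | add x y _ _ hx hy =>
    obtain ⟨x, hx, rfl⟩ := hx
    obtain ⟨y, hy, rfl⟩ := hy
    exact ⟨x + y, add_mem hx hy, map_add _ _ _⟩
  | neg x _ hx =>
    obtain ⟨x, hx, rfl⟩ := hx
    exact ⟨-x, neg_mem hx, map_neg _ _⟩

/-- The degree `d` part of the quasi-symmetric algebra is the image of that of `Sym_A(a)`. -/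
lemma mem_degree_iff (ψ : S →+* A) (a : Ideal A) {d : ℕ} {t : QSym ψ a} :
    t ∈ degree ψ a d ↔ ∃ z ∈ LinearMap.range (SymmetricAlgebra.ι A a) ^ d, inl ψ a z = t := by
  refine ⟨exists_inl_eq_of_mem_degree ψ a, ?_⟩
  rintro ⟨z, hz, rfl⟩
  exact AddSubgroup.subset_closure
    ⟨d, 0, z, 1, add_zero d, hz, ⟨1, rfl⟩, by rw [map_one, mul_one]⟩

/-- Sym_A(a) does not see the ambient ring. This is what transports both generators and degrees
between R and S. -/
lemma map_id_inl (w : ψ.comp α = (RingHom.id A).comp φ) (a : Ideal A)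
    (h : a ≤ a.comap (RingHom.id A)) (z : SymmetricAlgebra A a) :
    map φ a ψ a α (RingHom.id A) w h (inl φ a z) = inl ψ a z := by
  rw [map_inl, symMap_id, RingHom.id_apply]

lemma map_mem_degree_iff (hα : α.FormallySmooth) (w : ψ.comp α = (RingHom.id A).comp φ)
    (hφ : Function.Surjective φ) (a : Ideal A) (h : a ≤ a.comap (RingHom.id A)) (d : ℕ)
    (t : QSym φ a) :
    map φ a ψ a α (RingHom.id A) w h t ∈ degree ψ a d ↔ t ∈ degree φ a d := by
  simp_rw [mem_degree_iff, ← map_id_inl w a h,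
    (map_injective_of_formallySmooth hα w hφ a h).eq_iff]

end QSym

end Local

/-! ### From stalks to sheaves on X -/

section Geometric

variable {X Y M N : Scheme.{u}} (f : Y ⟶ X) (i : X ⟶ M) (j : X ⟶ N) (π : N ⟶ M) (h : j ≫ π = i)

/-- Every point of N lies in the smooth locus of π, and membership there is formal smoothness of the
stalk map. -/
lemma stalkHom_formallySmooth [Smooth π] (x : X) : (stalkHom i j π h x).FormallySmooth := by
  subst h
  have e : M.presheaf.stalkSpecializes (specializes_refl (π (j x))) ≫ π.stalkMap (j x) =
      π.stalkMap (j x) := by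
    rw [TopCat.Presheaf.stalkSpecializes_refl, Category.id_comp]
  have hx : j x ∈ π.smoothLocus := by
    rw [π.smoothLocus_eq_top]
    trivial
  exact (congrArg (fun g => g.hom.FormallySmooth) e).mpr hx

lemma stalkMap_hom_surjective [IsClosedImmersion i] (x : X) :
    Function.Surjective (i.stalkMap x).hom :=
  i.stalkMap_surjective x

lemma qsymStalkMap_injective [Smooth π] [IsClosedImmersion i] (x : X) :
    Function.Injective (qsymStalkMap f i j π h x) :=
  QSym.map_injective_of_formallySmooth (stalkHom_formallySmooth i j π h x) _
    (stalkMap_hom_surjective i x) _ _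

lemma qsymSectionsMap_injective [Smooth π] [IsClosedImmersion i] (U : X.Opens) :
    Function.Injective (qsymSectionsMap f i j π h U) := fun _ _ e =>
  Subtype.ext (funext fun x => qsymStalkMap_injective f i j π h x.1
    (congrFun (congrArg Subtype.val e) x))

/-- Elements of the quasi-symmetric algebra over an open subset of `N` come, locally on `X`, from
the quasi-symmetric algebra over open subsets of `M`. -/
lemma exists_qsymStalkMap_qsymGerm_eq (V : M.Opens) (V' : N.Opens) (hV : i ⁻¹ᵁ V ≤ j ⁻¹ᵁ V')
    (t : QSymOpen f j V') :
    ∃ t' : QSymOpen f i V, ∀ (x : X) (hx : x ∈ i ⁻¹ᵁ V),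
      qsymStalkMap f i j π h x (qsymGerm f i V x hx t') = qsymGerm f j V' x (hV hx) t := by
  obtain ⟨z, rfl⟩ := QSym.inl_surjective _ _ t
  -- A representative in Sym over j⁻¹V' involves only X, so its restriction to i⁻¹V also defines an
  -- element relative to M.
  refine ⟨QSym.inl _ _ (symMap (X.presheaf.map (homOfLE hV).op).hom _ _
    (idealSections_le_comap_map f hV) z), fun x hx => ?_⟩
  refine (congrArg (qsymStalkMap f i j π h x) (QSym.map_inl ..)).trans ?_
  refine (QSym.map_id_inl _ _ _ _).trans ?_
  refine Eq.trans ?_ (QSym.map_inl ..).symm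
  have e : (X.presheaf.germ (i ⁻¹ᵁ V) x hx).hom.comp (X.presheaf.map (homOfLE hV).op).hom =
      (X.presheaf.germ (j ⁻¹ᵁ V') x (hV hx)).hom :=
    congrArg CommRingCat.Hom.hom (X.presheaf.germ_res (homOfLE hV) x hx)
  refine congrArg (QSym.inl _ _) ?_
  have := symMap_comp (X.presheaf.map (homOfLE hV).op).hom (X.presheaf.germ (i ⁻¹ᵁ V) x hx).hom
    _ _ _ (idealSections_le_comap_map f hV) (idealSections_le_comap_germ f _ x hx)
    (e ▸ idealSections_le_comap_germ f _ x (hV hx))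
  refine (RingHom.congr_fun this z).trans ?_
  simp only [e]

/-- Preimages exist locally on X. By injectivity on stalks they agree on overlaps, hence glue. -/
lemma qsymSectionsMap_surjective [Smooth π] [IsClosedImmersion i] (U : X.Opens) :
    Function.Surjective (qsymSectionsMap f i j π h U) := by
  intro s
  have key (x : U) : ∃ (W : X.Opens) (_ : x.1 ∈ W) (V : M.Opens) (hV : W ≤ i ⁻¹ᵁ V)
      (t : QSymOpen f i V), ∀ (y : U) (hy : y.1 ∈ W),
        qsymStalkMap f i j π h y.1 (qsymGerm f i V y.1 (hV hy) t) = s.1 y := by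
    obtain ⟨W, hxW, k, V', hV', t, ht⟩ := s.2 x
    -- X carries the topology induced from M, so the neighbourhood W is itself the trace of an open
    -- set of M.
    obtain ⟨V, hV, hVW⟩ := i.isClosedEmbedding.isInducing.isOpen_iff.mp W.2
    obtain rfl : i ⁻¹ᵁ (⟨V, hV⟩ : M.Opens) = W := Opens.ext hVW
    have hle : i ⁻¹ᵁ (⟨V, hV⟩ : M.Opens) ≤ j ⁻¹ᵁ V' := fun y hy => hV' ⟨y, hy⟩
    obtain ⟨t', ht'⟩ := exists_qsymStalkMap_qsymGerm_eq f i j π h ⟨V, hV⟩ V' hle t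
    exact ⟨_, hxW, ⟨V, hV⟩, le_rfl, t', fun y hy => (ht' y.1 hy).trans (ht ⟨y.1, hy⟩).symm⟩
  choose W hxW V hV t ht using key
  -- The value at x is the germ of the local preimage chosen for x itself. At a nearby y the two
  -- choices have the same image s(y), hence coincide.
  let s' (x : U) : QSymStalk f i x.1 := qsymGerm f i (V x) x.1 (hV x (hxW x)) (t x)
  have hs' (x : U) : qsymStalkMap f i j π h x.1 (s' x) = s.1 x := ht x x (hxW x)
  refine ⟨⟨s', fun x => ⟨W x ⊓ U, ⟨hxW x, x.2⟩, homOfLE inf_le_right, V x,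
    fun y => hV x y.2.1, t x, fun y => ?_⟩⟩, Subtype.ext (funext hs')⟩
  exact qsymStalkMap_injective f i j π h y.1 ((hs' ⟨y.1, y.2.2⟩).trans
    (ht x ⟨y.1, y.2.2⟩ y.2.1).symm)

/-- Bijectivity over every open set suffices: isomorphisms are reflected from presheaves to sheaves,
and from sheaves of rings to sheaves of rings under 𝒪_X. -/
lemma isIso_qsymAlgebraMap [Smooth π] [IsClosedImmersion i] [IsClosedImmersion j] :
    IsIso (qsymAlgebraMap f i j π h) := by
  have (U : (Opens X)ᵒᵖ) : IsIso ((qsymSheafMap f i j π h).hom.app U) :=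
    (ConcreteCategory.isIso_iff_bijective _).mpr
      ⟨qsymSectionsMap_injective f i j π h U.unop, qsymSectionsMap_surjective f i j π h U.unop⟩
  have : IsIso (qsymSheafMap f i j π h).hom := NatIso.isIso_of_isIso_app _
  have : IsIso (qsymSheafMap f i j π h) :=
    (isIso_iff_of_reflects_iso _ (sheafToPresheaf _ _)).mp this
  exact (isIso_iff_of_reflects_iso _ (Under.forget _)).mp this

lemma qsymSectionsMap_mem_qsymDegree_iff [Smooth π] [IsClosedImmersion i] (U : X.Opens) (d : ℕ)
    (s : qsymSections f i U) :
    qsymSectionsMap f i j π h U s ∈ qsymDegree f j U d ↔ s ∈ qsymDegree f i U d :=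
  forall_congr' fun x => QSym.map_mem_degree_iff (stalkHom_formallySmooth i j π h x.1)
    (stalkMap_comp_stalkHom i j π h x.1) (stalkMap_hom_surjective i x.1) _ _ d (s.1 x)

end Geometric

end QuasiSym

theorem mainTheorem8 {k : Type u} [Field k] {X M N : Scheme.{u}}
    (sM : M ⟶ Spec (CommRingCat.of k)) (sN : N ⟶ Spec (CommRingCat.of k))
    [LocallyOfFiniteType sM] [QuasiCompact sM] [LocallyOfFiniteType sN] [QuasiCompact sN]
    (π : N ⟶ M) (hπ : π ≫ sM = sN) [Smooth π]
    (i : X ⟶ M) (j : X ⟶ N) [IsClosedImmersion i] [IsClosedImmersion j] (h : j ≫ π = i) :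
    ∀ (Y : Scheme.{u}) (f : Y ⟶ X) [IsClosedImmersion f],
      IsIso (QuasiSym.qsymAlgebraMap f i j π h) ∧
      ∀ (U : X.Opens) (d : ℕ) (s : QuasiSym.qsymSections f i U),
        QuasiSym.qsymSectionsMap f i j π h U s ∈ QuasiSym.qsymDegree f j U d ↔
          s ∈ QuasiSym.qsymDegree f i U d := by
  exact fun Y f _ => ⟨QuasiSym.isIso_qsymAlgebraMap f i j π h,
    QuasiSym.qsymSectionsMap_mem_qsymDegree_iff f i j π h⟩
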